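/- Let $\Bbbk$ be a field of characteristic zero, let $n\ge 1$, and let $R=\Bbbk[x_1,\dots,x_n]$ with the standard grading. Let $d_1,\dots,d_n$ be nonnegative integers and let $\alpha_1,\dots,\alpha_n$ be integers such that $0\le\alpha_i\le d_i$ for all $i$ and $d_1=\alpha_2+\dots+\alpha_n$. Let $c\in\Bbbk$ be nonzero, with $c\neq-1$ in case $d_1=0$ (so that the binomial below is not the zero polynomial), and define the ideal \[K'=(x_1^{d_1}+c\,x_2^{\alpha_2}\cdots x_n^{\alpha_n},\,x_2^{d_2},\dots,x_n^{d_n})+x_1^{d_1-\alpha_1}(x_2^{d_2-\alpha_2},\dots,x_n^{d_n-\alpha_n}).\] Then, unless $K'=R$, the ring $R/K'$ is Gorenstein and has the strong Lefschetz property (SLP). Here a graded quotient $A=R/I$ by a homogeneous ideal $I$ has the SLP if $A$ is Artinian and there is a linear form $\ell\in A_1$ such that for all $e,i\ge 0$ the multiplication map $\ell^e\colon A_i\to A_{i+e}$ has maximal rank, i.e. is injective or surjective. -/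

import Mathlib

universe u v

attribute [local instance] MvPolynomial.gradedAlgebra

/-- A commutative ring is Gorenstein if it is Noetherian and each of its localizations at a prime
ideal has finite injective dimension as a module over itself. -/
def IsGorensteinRing (A : Type u) [CommRing A] : Prop :=
  IsNoetherianRing A ∧
    ∀ (P : Ideal A) [P.IsPrime], ∃ m : ℕ,
      CategoryTheory.HasInjectiveDimensionLE
        (ModuleCat.of (Localization.AtPrime P) (Localization.AtPrime P)) m

/-- The degree `i` component of the quotient of a standard graded polynomial ring by a
homogeneous ideal `I`: the set of classes of forms of degree `i`. -/
noncomputable def quotientComponent {σ : Type v} {k : Type u} [Field k]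
    (I : Ideal (MvPolynomial σ k)) (i : ℕ) : Submodule k (MvPolynomial σ k ⧸ I) :=
  (MvPolynomial.homogeneousSubmodule σ k i).map (Ideal.Quotient.mkₐ k I).toLinearMap

/-- The strong Lefschetz property of the algebra `A = k[x_j : j ∈ σ] / I`: the ideal `I` is
homogeneous, `A` is Artinian, and there is a linear form `ℓ` such that, for all `e` and `i`,
multiplication by `ℓ ^ e` from `A_i` to `A_{i+e}` has maximal rank, that is, it is injective or
surjective. -/
structure HasSLP {σ : Type v} {k : Type u} [Field k] (I : Ideal (MvPolynomial σ k)) : Prop where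
  homogeneous : I.IsHomogeneous (MvPolynomial.homogeneousSubmodule σ k)
  artinian : IsArtinianRing (MvPolynomial σ k ⧸ I)
  exists_lefschetz : ∃ l ∈ quotientComponent I 1, ∀ e i : ℕ,
    Set.InjOn (fun a => l ^ e * a) (quotientComponent I i) ∨
      Set.SurjOn (fun a => l ^ e * a) (quotientComponent I i) (quotientComponent I (i + e))

/-- The ideal
`(x_1^{d_1} + c x_2^{α_2} ⋯ x_n^{α_n}, x_2^{d_2}, …, x_n^{d_n})
  + x_1^{d_1-α_1} (x_2^{d_2-α_2}, …, x_n^{d_n-α_n})`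
of `k[x_1, …, x_n]`, where `n = m + 1`, the variable `x_1` is `X 0` and the variables
`x_2, …, x_n` are the `X j.succ` with `j : Fin m`. -/
noncomputable def binomialIdeal {k : Type u} [Field k] {m : ℕ} (d α : Fin (m + 1) → ℕ) (c : k) :
    Ideal (MvPolynomial (Fin (m + 1)) k) :=
  Ideal.span
      ({MvPolynomial.X 0 ^ d 0 +
          MvPolynomial.C c * ∏ j : Fin m, MvPolynomial.X j.succ ^ α j.succ} ∪
        Set.range fun j : Fin m => MvPolynomial.X j.succ ^ d j.succ) +
    Ideal.span {MvPolynomial.X 0 ^ (d 0 - α 0)} *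
      Ideal.span (Set.range fun j : Fin m => MvPolynomial.X j.succ ^ (d j.succ - α j.succ))

/-! ### Representations of `sl₂` and the Casimir operator. -/

section SlTwo

variable {k : Type*} [Field k] [CharZero k] {V : Type*} [AddCommGroup V] [Module k V]
  {E F H : Module.End k V}

/-! The quotient has a basis of monomials filling two boxes of exponents: `v 0 < d 0 - α 0`, `v j <
d j`, and `d 0 - α 0 ≤ v 0 < d 0`, `v j < d j - α j` (with `j` over the other variables). They span
because x_1^{d_1} can be rewritten as -c x_2^{α_2}⋯x_n^{α_n} (`mon_mem_span`). A functional killing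
the ideal, with powers of -c as its nonzero coefficients, pairs each basis monomial to a nonzero
scalar with its mirror image in its own box and to zero with all other mirror images
(`exists_functional_nondegenerate`). This gives independence, and a nondegenerate pairing makes the
algebra self-injective, hence Gorenstein.

For the Lefschetz property, truncate multiplication by x_1 to the shift inside each box. A box then
carries a tensor product of irreducible `sl₂`-representations, and d_1 = α_2 + ⋯ + α_n makes the two
boxes concentric in degree (`socleDegree_add`), so powers of the sum of shifts are injective from
degree `i` to degree `D - i` (`eq_zero_of_sum_boxRaise_pow_eq_zero`). That sum is the limit as μ → 0
of diagonal conjugates of multiplication by μ² x_1 + x_2 + ⋯ + x_n. Injectivity is an open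
condition, so some nonzero μ works (`exists_injective_of_initial_injective`). Symmetry of the
Hilbert function upgrades injectivity to bijectivity, and `maximal_rank_of_narrow` yields all
maximal rank statements. -/

lemma weight_pow_of_commutator (w : k) (hHF : H * F - F * H = w • F) {v : V} {r : k}
    (hv : H v = r • v) (n : ℕ) : H ((F ^ n) v) = (r + n * w) • (F ^ n) v := by
  induction n with
  | zero => simpa using hv
  | succ n ih =>
    have h := LinearMap.congr_fun hHF ((F ^ n) v)
    simp only [LinearMap.sub_apply, Module.End.mul_apply, LinearMap.smul_apply, ih, map_smul,
      sub_eq_iff_eq_add] at h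
    rw [pow_succ', Module.End.mul_apply, h, ← add_smul]
    push_cast
    ring_nf

/-- The weights `r - 2n` are distinct in characteristic zero, so nonzero vectors `(F ^ n) v` for all
`n` would form an infinite independent family. -/
lemma exists_pow_apply_ne_zero_and_succ_eq_zero [FiniteDimensional k V]
    (hHF : H * F - F * H = (-2 : k) • F) {v : V} {r : k} (hv : H v = r • v) (hv0 : v ≠ 0) :
    ∃ n : ℕ, (F ^ n) v ≠ 0 ∧ (F ^ (n + 1)) v = 0 := by
  suffices ∃ n : ℕ, (F ^ n) v = 0 by
    obtain ⟨n, h₁, h₂⟩ := Nat.exists_not_and_succ_of_not_zero_of_exists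
      (p := fun n => (F ^ n) v = 0) (by simpa using hv0) this
    exact ⟨n, h₁, h₂⟩
  by_contra! h
  have hinj : Function.Injective fun n : ℕ => r + n * (-2 : k) := fun a b hab => by
    simpa using hab
  have hli := Module.End.eigenvectors_linearIndependent' H _ hinj (fun n => (F ^ n) v)
    fun n => ⟨Module.End.mem_eigenspace_iff.2 (weight_pow_of_commutator _ hHF hv n), h n⟩
  exact not_finite_iff_infinite.2 (inferInstance : Infinite ℕ) hli.finite

/-- For a finite-dimensional representation of `sl₂` in characteristic zero, the `h`-th power of
the raising operator is injective on the weight space of weight `-h`. -/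
theorem eq_zero_of_raising_pow_eq_zero [FiniteDimensional k V]
    (hEF : E * F - F * E = H) (hHE : H * E - E * H = (2 : k) • E)
    (hHF : H * F - F * H = (-2 : k) • F) (h : ℕ) {v : V} (hv : H v = (-h : k) • v)
    (hEv : (E ^ h) v = 0) : v = 0 := by
  -- induct on the least power of `E` killing `v`, lowering it by the Casimir operator `Ω`
  suffices ∀ j ≤ h, ∀ v : V, H v = (-h : k) • v → (E ^ j) v = 0 → v = 0 from
    this h le_rfl v hv hEv
  clear hv hEv v
  set Ω : Module.End k V := (4 : k) • (F * E) + H * H + (2 : k) • H with hΩ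
  have hΩ' : Ω = (4 : k) • (E * F) + H * H - (2 : k) • H := by
    rw [hΩ, ← hEF]; simp only [smul_sub]; module
  have hHE' : H * E = E * H + (2 : k) • E := by rw [← hHE]; abel
  have hHF' : H * F = F * H + (-2 : k) • F := by rw [← hHF]; abel
  have hFE' : F * E = E * F - H := by rw [← hEF]; abel
  have hΩE : Commute E Ω := by
    have h1 : E * Ω = (4 : k) • (E * F * E) + E * H * H + (2 : k) • (E * H) := by
      simp only [hΩ, mul_add, mul_smul_comm, mul_assoc]
    have h2 : Ω * E = (4 : k) • (E * F * E) + E * H * H + (2 : k) • (E * H) := by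
      simp only [hΩ', add_mul, sub_mul, smul_mul_assoc, mul_assoc, hHE', mul_add, mul_smul_comm]
      simp only [← mul_assoc, hHE', add_mul, smul_mul_assoc]
      module
    exact h1.trans h2.symm
  have hΩF : Commute F Ω := by
    have h1 : F * Ω = (4 : k) • (F * E * F) + F * H * H - (2 : k) • (F * H) := by
      simp only [hΩ', mul_add, mul_sub, mul_smul_comm, mul_assoc]
    have h2 : Ω * F = (4 : k) • (F * E * F) + F * H * H - (2 : k) • (F * H) := by
      simp only [hΩ, add_mul, smul_mul_assoc, mul_assoc, hHF', mul_add, mul_smul_comm]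
      simp only [← mul_assoc, hHF', add_mul, smul_mul_assoc]
      module
    exact h1.trans h2.symm
  have hΩH : Commute H Ω := by
    rw [← hEF]; exact (hΩE.mul_left hΩF).sub_left (hΩF.mul_left hΩE)
  intro j
  induction j with
  | zero => intro _ v _ h0; simpa using h0
  | succ j ih =>
    intro hj v hv hEv
    by_contra hv0
    have hwt := weight_pow_of_commutator _ hHE hv j
    -- The weight of `(E ^ j) v`. This vector is killed by `E`, so `Ω` acts on it by `m * (m + 2)`.
    set m : k := -h + j * 2 with hm
    have hu : Ω ((E ^ j) v) = (m * (m + 2)) • (E ^ j) v := by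
      have : E ((E ^ j) v) = 0 := by rw [← hEv, pow_succ']; rfl
      simp only [hΩ, LinearMap.add_apply, LinearMap.smul_apply, Module.End.mul_apply, this, hwt,
        map_smul, map_zero, smul_zero]
      module
    have hΩv : Ω v - (m * (m + 2)) • v = 0 := by
      apply ih (by omega)
      · have := LinearMap.congr_fun hΩH.eq v
        simp only [Module.End.mul_apply, hv, map_smul] at this
        rw [map_sub, map_smul, this, hv]; module
      · have := LinearMap.congr_fun (hΩE.pow_left j).eq v
        simp only [Module.End.mul_apply] at this
        rw [map_sub, map_smul, this, hu, sub_self]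
    obtain ⟨r, hr0, hr⟩ := exists_pow_apply_ne_zero_and_succ_eq_zero hHF hv hv0
    have hwr := weight_pow_of_commutator _ hHF hv r
    have h1 : Ω ((F ^ r) v) = (m * (m + 2)) • (F ^ r) v := by
      have := LinearMap.congr_fun (hΩF.pow_left r).eq v
      simp only [Module.End.mul_apply, sub_eq_zero.1 hΩv, map_smul] at this
      exact this.symm
    -- `(F ^ r) v` is a lowest weight vector, of weight `-(h + 2r)`, which gives a second value for
    -- the same Casimir scalar.
    have h2 : Ω ((F ^ r) v) = ((h + 2 * r : k) * (h + 2 * r + 2)) • (F ^ r) v := by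
      have : F ((F ^ r) v) = 0 := by rw [← hr, pow_succ']; rfl
      simp only [hΩ', LinearMap.add_apply, LinearMap.sub_apply, LinearMap.smul_apply,
        Module.End.mul_apply, this, hwr, map_smul, map_zero, smul_zero]
      module
    have h3 := smul_left_injective k hr0 (h1.symm.trans h2)
    have h4 : ((-h + j * 2 : ℤ) * (-h + j * 2 + 2)) = (h + 2 * r) * (h + 2 * r + 2) := by
      rw [hm] at h3; exact_mod_cast h3
    -- Equal values of t(t + 2) force `m = h + 2r` or `m = -h - 2r - 2`; both are impossible for `0
    -- ≤ j < h`.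
    have h5 : ((j : ℤ) * 2 - 2 * h - 2 * r) * (2 * j + 2 + 2 * r) = 0 := by linarith
    rcases mul_eq_zero.1 h5 with h6 | h6 <;> omega

end SlTwo

/-! ### Openness of injectivity and degeneration along a weight. -/

section Deformation

open Polynomial

/-- Injectivity on finitely many subspaces of the members of a polynomial family of matrices is an
open condition. -/
lemma exists_eval_injective_of_eval_zero {k : Type*} [Field k] [Infinite k] {S : Type*} [Fintype S]
    [DecidableEq S] {ι : Type*} (J : Finset ι) (A : ι → Matrix S S k[X])
    (U : ι → Submodule k (S → k))
    (h0 : ∀ j ∈ J, ∀ v ∈ U j, ((A j).map (eval 0)).mulVec v = 0 → v = 0) :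
    ∃ μ : k, μ ≠ 0 ∧ ∀ j ∈ J, ∀ v ∈ U j, ((A j).map (eval μ)).mulVec v = 0 → v = 0 := by
  classical
  have key : ∀ j ∈ J, ∃ p : k[X], p ≠ 0 ∧
      ∀ μ, eval μ p ≠ 0 → ∀ v ∈ U j, ((A j).map (eval μ)).mulVec v = 0 → v = 0 := by
    intro j hj
    let b := Module.finBasis k (U j)
    let f (μ : k) : U j →ₗ[k] (S → k) := (Matrix.toLin' ((A j).map (eval μ))) ∘ₗ (U j).subtype
    have hf : LinearMap.ker (f 0) = ⊥ := by
      rw [LinearMap.ker_eq_bot']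
      intro v hv
      exact Subtype.ext (h0 j hj v v.2 hv)
    obtain ⟨g, hg⟩ := LinearMap.exists_leftInverse_of_injective _ hf
    let G := LinearMap.toMatrix (Pi.basisFun k S) b g
    let T := LinearMap.toMatrix b (Pi.basisFun k S) (U j).subtype
    -- `G` is a left inverse at the parameter 0, so `p` takes the value 1 there; wherever `p` is
    -- nonzero the restricted map is injective.
    let p : k[X] := (G.map C * A j * T.map C).det
    have hp (μ : k) : eval μ p = LinearMap.det (g ∘ₗ f μ) := by
      rw [← LinearMap.det_toMatrix b, LinearMap.toMatrix_comp b (Pi.basisFun k S) b,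
        LinearMap.toMatrix_comp b (Pi.basisFun k S) (Pi.basisFun k S), ← coe_evalRingHom,
        RingHom.map_det]
      congr 1
      simp only [RingHom.mapMatrix_apply, Matrix.map_mul, Matrix.map_map, Matrix.mul_assoc]
      have hC : (evalRingHom μ : k[X] → k) ∘ C = id := by ext; simp
      rw [hC, Matrix.map_id, Matrix.map_id, ← Matrix.toLin'_toMatrix' (Matrix.toLin' _)]
      simp only [LinearMap.toMatrix_eq_toMatrix', LinearMap.toMatrix'_toLin']
      rfl
    refine ⟨p, fun h => ?_, fun μ hμ v hv hAv => ?_⟩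
    · have := hp 0
      rw [h, hg] at this
      simp at this
    · rw [hp] at hμ
      have hi := (LinearMap.equivOfDetNeZero _ hμ).injective
      have : (⟨v, hv⟩ : U j) = 0 := by
        apply hi
        rw [map_zero]
        change g (((A j).map (eval μ)).mulVec v) = 0
        rw [hAv, map_zero]
      simpa using this
  choose! p hp0 hp using key
  -- The factor `X` keeps the chosen parameter away from 0.
  have hP : X * ∏ j ∈ J, p j ≠ 0 := mul_ne_zero X_ne_zero (Finset.prod_ne_zero_iff.2 hp0)
  obtain ⟨μ, hμ⟩ : ∃ μ, eval μ (X * ∏ j ∈ J, p j) ≠ 0 := by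
    by_contra! h
    exact hP (Polynomial.funext (by simpa using h))
  rw [eval_mul, eval_X, eval_prod] at hμ
  exact ⟨μ, left_ne_zero_of_mul hμ, fun j hj =>
    hp j hj μ (Finset.prod_ne_zero_iff.1 (right_ne_zero_of_mul hμ) j hj)⟩

/-- Let `M` be the part of `Y + T` of top weight, where `Y` has weight `0` and `T` has weight at
most `2`. If powers of `M` are injective on coordinate subspaces, then so are the same powers of
`Y + μ² T` for some `μ ≠ 0`. -/
lemma exists_injective_of_initial_injective {k : Type*} [Field k] [Infinite k] {S : Type*}
    [Fintype S] [DecidableEq S] (Y T M : Matrix S S k) (w : S → ℕ)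
    (hY : ∀ t s, Y t s ≠ 0 → w t = w s) (hT : ∀ t s, T t s ≠ 0 → w t ≤ w s + 2)
    (hM : ∀ t s, M t s = Y t s + if w t = w s + 2 then T t s else 0)
    {ι : Type*} (J : Finset ι) (e : ι → ℕ) (P : ι → Set S)
    (h0 : ∀ j ∈ J, ∀ v : S → k, (∀ s ∉ P j, v s = 0) → (M ^ e j).mulVec v = 0 → v = 0) :
    ∃ μ : k, μ ≠ 0 ∧ ∀ j ∈ J, ∀ v : S → k, (∀ s ∉ P j, v s = 0) →
      ((Y + μ ^ 2 • T) ^ e j).mulVec v = 0 → v = 0 := by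
  let U (j : ι) : Submodule k (S → k) :=
    { carrier := {v | ∀ s ∉ P j, v s = 0}
      add_mem' := fun {a b} ha hb s hs => by simp [ha s hs, hb s hs]
      zero_mem' := fun s _ => rfl
      smul_mem' := fun c a ha s hs => by simp [ha s hs] }
  -- Conjugating `Y + μ² T` by the diagonal matrix of the `μ ^ w s` gives this family. The truncated
  -- exponent is harmless, as `T t s` vanishes when `w t > w s + 2`; at 0 only the entries with `w t
  -- = w s + 2` of `T` survive.
  let N : Matrix S S k[X] := Matrix.of fun t s => C (Y t s) + C (T t s) * X ^ (w s + 2 - w t)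
  have hmap (μ : k) (n : ℕ) : (N ^ n).map (eval μ) = (N.map (eval μ)) ^ n :=
    map_pow (evalRingHom μ).mapMatrix N n
  have hN0 : N.map (eval 0) = M := by
    ext t s
    rw [hM]
    simp only [N, Matrix.map_apply, Matrix.of_apply, eval_add, eval_C, eval_mul, eval_pow, eval_X]
    congr 1
    split_ifs with h
    · simp [h]
    · by_cases hts : T t s = 0
      · simp [hts]
      · have := hT t s hts
        rw [zero_pow (by omega), mul_zero]
  obtain ⟨μ, hμ, H⟩ := exists_eval_injective_of_eval_zero J (fun j => N ^ e j) U (by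
    intro j hj v hv
    rw [hmap, hN0]
    exact h0 j hj v hv)
  refine ⟨μ, hμ, fun j hj v hv hLv => ?_⟩
  let D : Matrix S S k := Matrix.diagonal fun s => μ ^ w s
  have hDN : SemiconjBy D (N.map (eval μ)) (Y + μ ^ 2 • T) := by
    ext t s
    simp only [D, N, Matrix.diagonal_mul, Matrix.mul_diagonal, Matrix.map_apply, Matrix.of_apply,
      eval_add, eval_C, eval_mul, eval_pow, eval_X, Matrix.add_apply, Matrix.smul_apply,
      smul_eq_mul, mul_add, add_mul]
    congr 1
    · by_cases h : Y t s = 0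
      · simp [h]
      · rw [hY t s h, mul_comm]
    · by_cases h : T t s = 0
      · simp [h]
      · have := hT t s h
        calc μ ^ w t * (T t s * μ ^ (w s + 2 - w t))
            = T t s * μ ^ (w t + (w s + 2 - w t)) := by rw [pow_add]; ring
          _ = _ := by rw [Nat.add_sub_cancel' this, pow_add]; ring
  let v' : S → k := fun s => (μ ^ w s)⁻¹ * v s
  have hv' : D.mulVec v' = v := by
    ext s
    simp [D, v', Matrix.mulVec_diagonal, hμ]
  have hinjD : ∀ x, D.mulVec x = 0 → x = 0 := fun x hx => by
    ext s
    have := congrFun hx s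
    simpa [D, Matrix.mulVec_diagonal, hμ] using this
  have : v' = 0 := by
    refine H j hj v' (fun s hs => by simp [v', hv s hs]) (hinjD _ ?_)
    rw [hmap, Matrix.mulVec_mulVec, (hDN.pow_right (e j)).eq, ← Matrix.mulVec_mulVec, hv', hLv]
  rw [← hv', this, Matrix.mulVec_zero]

end Deformation

/-! ### Self-injectivity from a nondegenerate functional. -/

section Gorenstein

/-- A finite-dimensional commutative algebra with a nondegenerate functional is self-injective. -/
lemma baer_self_of_nondegenerate {k A : Type*} [Field k] [CommRing A] [Algebra k A]
    [FiniteDimensional k A] (φ : A →ₗ[k] k) (hφ : ∀ a, (∀ b, φ (a * b) = 0) → a = 0) :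
    Module.Baer A A := by
  intro I g
  let Φ : A →ₗ[k] Module.Dual k A := (LinearMap.mul k A).compr₂ φ
  have hΦ : Function.Injective Φ := by
    rw [← LinearMap.ker_eq_bot, LinearMap.ker_eq_bot']
    exact fun a ha => hφ a fun b => LinearMap.congr_fun ha b
  have hΦs : Function.Surjective Φ :=
    (LinearMap.injective_iff_surjective_of_finrank_eq_finrank
      Subspace.dual_finrank_eq.symm).1 hΦ
  -- Extend `φ ∘ g` linearly from the ideal to the algebra and represent it as `φ (b * ·)`;
  -- nondegeneracy then forces `g` to be multiplication by `b`.
  obtain ⟨ψ, hψ⟩ := LinearMap.exists_extend (p := I.restrictScalars k)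
    (φ ∘ₗ (g.restrictScalars k : I.restrictScalars k →ₗ[k] A))
  obtain ⟨b, hb⟩ := hΦs ψ
  refine ⟨LinearMap.mulLeft A b, fun x hx => ?_⟩
  rw [LinearMap.mulLeft_apply, ← sub_eq_zero]
  refine hφ _ fun y => ?_
  have hxy : x * y ∈ I := I.mul_mem_right y hx
  have h1 : ψ (x * y) = φ (g ⟨x * y, hxy⟩) := LinearMap.congr_fun hψ ⟨x * y, hxy⟩
  have h2 : g ⟨x * y, hxy⟩ = y * g ⟨x, hx⟩ := by
    have h := g.map_smul y ⟨x, hx⟩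
    rw [smul_eq_mul] at h
    rw [← h]
    congr 1
    exact Subtype.ext (mul_comm x y)
  have h3 : φ (b * (x * y)) = ψ (x * y) := by rw [← hb]; rfl
  rw [sub_mul, map_sub, mul_assoc, h3, h1, h2, mul_comm y, sub_self]

/-- Over a Noetherian ring injectivity survives localization, so every local ring has injective
dimension 0 over itself. -/
lemma isGorensteinRing_of_nondegenerate {k A : Type*} [Field k] [CommRing A] [Algebra k A]
    [FiniteDimensional k A] (φ : A →ₗ[k] k) (hφ : ∀ a, (∀ b, φ (a * b) = 0) → a = 0) :
    IsGorensteinRing A := by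
  have hN : IsNoetherianRing A := IsNoetherianRing.of_finite k A
  refine ⟨hN, fun P _ => ⟨0, ?_⟩⟩
  have hA : Module.Injective A A := (baer_self_of_nondegenerate φ hφ).injective
  have := Module.injective_of_isLocalizedModule (Rₛ := Localization.AtPrime P) P.primeCompl
    (Algebra.linearMap A (Localization.AtPrime P))
  rw [Module.injective_iff_injective_object] at this
  simpa [CategoryTheory.HasInjectiveDimensionLE,
    ← CategoryTheory.injective_iff_hasInjectiveDimensionLT_one] using this

end Gorenstein

/-! ### The `sl₂`-action on a disjoint union of boxes. -/

section Box

open Finsupp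

/-- The exponents in a disjoint union of boxes, of which the one labelled `q` has side lengths
`sz q i`. -/
abbrev BoxIndex {Q σ : Type*} (sz : Q → σ → ℕ) : Type _ :=
  {s : Q × (σ →₀ ℕ) // ∀ i, s.2 i < sz s.1 i}

instance BoxIndex.finite {Q σ : Type*} [Finite Q] [Finite σ] (sz : Q → σ → ℕ) :
    Finite (BoxIndex sz) := by
  refine Finite.of_injective
    (fun s : BoxIndex sz => (⟨s.1.1, fun i => ⟨s.1.2 i, s.2 i⟩⟩ : Σ q, ∀ i, Fin (sz q i))) ?_
  rintro ⟨⟨q, u⟩, hu⟩ ⟨⟨q', u'⟩, hu'⟩ h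
  simp only [Sigma.mk.injEq] at h
  obtain ⟨rfl, h⟩ := h
  have : u = u' := by
    ext i
    exact congrArg Fin.val (congrFun (eq_of_heq h) i)
  subst this
  rfl

variable {k : Type*} [Field k] {V : Type*} [AddCommGroup V] [Module k V] {Q σ : Type*}
  {sz : Q → σ → ℕ} (b : Module.Basis (BoxIndex sz) k V)

open Classical in
/-- The basis vector with a given exponent, understood to be zero outside the boxes. -/
noncomputable def boxVec (q : Q) (u : σ →₀ ℕ) : V :=
  if h : ∀ i, u i < sz q i then b ⟨(q, u), h⟩ else 0

lemma boxVec_coe (s : BoxIndex sz) : boxVec b s.1.1 s.1.2 = b s := dif_pos s.2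

lemma boxVec_of_lt {q : Q} {u : σ →₀ ℕ} (h : ∀ i, u i < sz q i) :
    boxVec b q u = b ⟨(q, u), h⟩ := dif_pos h

lemma boxVec_of_le {q : Q} {u : σ →₀ ℕ} {i : σ} (h : sz q i ≤ u i) : boxVec b q u = 0 :=
  dif_neg fun hlt => (hlt i).not_ge h

/-- The shift of the exponent in the direction `i`. -/
noncomputable def boxRaise (i : σ) : Module.End k V :=
  b.constr k fun s => boxVec b s.1.1 (s.1.2 + single i 1)

/-- The lowering operator of the `sl₂`-triple in the direction `i`. -/
noncomputable def boxLower (i : σ) : Module.End k V :=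
  b.constr k fun s => ((s.1.2 i : k) * (sz s.1.1 i - s.1.2 i)) •
    boxVec b s.1.1 (s.1.2 - single i 1)

/-- The weight operator of the `sl₂`-triple in the direction `i`. -/
noncomputable def boxWeight (i : σ) : Module.End k V :=
  b.constr k fun s => (2 * (s.1.2 i : k) - sz s.1.1 i + 1) • b s

lemma boxRaise_boxVec (i : σ) (q : Q) (u : σ →₀ ℕ) :
    boxRaise b i (boxVec b q u) = boxVec b q (u + single i 1) := by
  by_cases h : ∀ i, u i < sz q i
  · rw [boxVec_of_lt b h, boxRaise, Module.Basis.constr_basis]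
  · push Not at h
    obtain ⟨j, hj⟩ := h
    rw [boxVec_of_le b hj, boxVec_of_le b (hj.trans (by simp : u j ≤ _)), map_zero]

/-- The coefficient vanishes at `u i = sz q i`, the only place where lowering could re-enter a box
from outside, so the formula is compatible with extension by zero. -/
lemma boxLower_boxVec (i : σ) (q : Q) (u : σ →₀ ℕ) :
    boxLower b i (boxVec b q u) =
      ((u i : k) * (sz q i - u i)) • boxVec b q (u - single i 1) := by
  classical
  by_cases h : ∀ i, u i < sz q i
  · rw [boxVec_of_lt b h, boxLower, Module.Basis.constr_basis]
  · push Not at h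
    obtain ⟨j, hj⟩ := h
    rw [boxVec_of_le b hj, map_zero]
    by_cases hji : j = i
    · subst hji
      rcases hj.eq_or_lt with h | h
      · simp [h]
      · rw [boxVec_of_le b (i := j), smul_zero]
        simp
        omega
    · rw [boxVec_of_le b (i := j), smul_zero]
      simpa [single_apply, Ne.symm hji] using hj

lemma boxWeight_boxVec (i : σ) (q : Q) (u : σ →₀ ℕ) :
    boxWeight b i (boxVec b q u) = (2 * (u i : k) - sz q i + 1) • boxVec b q u := by
  by_cases h : ∀ i, u i < sz q i
  · rw [boxVec_of_lt b h, boxWeight, Module.Basis.constr_basis]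
  · push Not at h
    obtain ⟨j, hj⟩ := h
    rw [boxVec_of_le b hj, map_zero, smul_zero]

lemma boxVec_hom_ext {f g : Module.End k V}
    (h : ∀ q u, f (boxVec b q u) = g (boxVec b q u)) : f = g :=
  b.ext fun s => by rw [← boxVec_coe]; exact h _ _

/-- With N the side length, u(N - u) - (u + 1)(N - u - 1) = 2u - N + 1. -/
lemma boxRaise_boxLower_self (i : σ) :
    boxRaise b i * boxLower b i - boxLower b i * boxRaise b i = boxWeight b i := by
  refine boxVec_hom_ext b fun q u => ?_
  simp only [LinearMap.sub_apply, Module.End.mul_apply, boxLower_boxVec, boxRaise_boxVec, map_smul,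
    boxWeight_boxVec, add_tsub_cancel_right]
  rcases Nat.eq_zero_or_pos (u i) with h | h
  · simp [h]
    rw [← neg_smul]
    ring_nf
  · have : u - single i 1 + single i 1 = u := by
      apply tsub_add_cancel_of_le
      rw [single_le_iff]
      exact h
    rw [this, ← sub_smul]
    simp
    ring_nf

lemma boxRaise_boxLower_of_ne {i j : σ} (hij : i ≠ j) :
    boxRaise b i * boxLower b j - boxLower b j * boxRaise b i = 0 := by
  refine boxVec_hom_ext b fun q u => ?_
  simp only [LinearMap.sub_apply, Module.End.mul_apply, boxLower_boxVec, boxRaise_boxVec, map_smul,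
    LinearMap.zero_apply]
  have hj : (u + single i 1 : σ →₀ ℕ) j = u j := by simp [hij]
  rw [hj]
  rcases Nat.eq_zero_or_pos (u j) with h | h
  · simp [h]
  · have : single j 1 ≤ u := by rw [single_le_iff]; exact h
    rw [tsub_add_eq_add_tsub this, sub_self]

variable [Fintype σ]

lemma sum_boxRaise_boxLower :
    (∑ i, boxRaise b i) * (∑ i, boxLower b i) - (∑ i, boxLower b i) * (∑ i, boxRaise b i) =
      ∑ i, boxWeight b i := by
  classical
  rw [Finset.sum_mul_sum, Finset.sum_mul_sum, Finset.sum_comm (s := Finset.univ)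
    (f := fun i j => boxLower b i * boxRaise b j), ← Finset.sum_sub_distrib]
  refine Finset.sum_congr rfl fun i _ => ?_
  rw [← Finset.sum_sub_distrib, Finset.sum_eq_single i]
  · exact boxRaise_boxLower_self b i
  · exact fun j _ hj => boxRaise_boxLower_of_ne b hj.symm
  · simp

lemma sum_boxWeight_boxVec (q : Q) (u : σ →₀ ℕ) :
    (∑ i, boxWeight b i) (boxVec b q u) =
      (∑ i, (2 * (u i : k) - sz q i + 1)) • boxVec b q u := by
  simp only [LinearMap.sum_apply, boxWeight_boxVec, Finset.sum_smul]

lemma sum_boxWeight_boxRaise :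
    (∑ i, boxWeight b i) * (∑ i, boxRaise b i) - (∑ i, boxRaise b i) * (∑ i, boxWeight b i) =
      (2 : k) • ∑ i, boxRaise b i := by
  classical
  rw [Finset.mul_sum, Finset.sum_mul, ← Finset.sum_sub_distrib, Finset.smul_sum]
  refine Finset.sum_congr rfl fun j _ => boxVec_hom_ext b fun q u => ?_
  simp only [LinearMap.sub_apply, Module.End.mul_apply, boxRaise_boxVec, map_smul,
    LinearMap.smul_apply, sum_boxWeight_boxVec, ← sub_smul, ← Finset.sum_sub_distrib]
  congr 1
  rw [Finset.sum_eq_single j]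
  · simp
    ring
  · intro i _ hi
    simp [hi.symm]
  · simp

lemma sum_boxWeight_boxLower :
    (∑ i, boxWeight b i) * (∑ i, boxLower b i) - (∑ i, boxLower b i) * (∑ i, boxWeight b i) =
      (-2 : k) • ∑ i, boxLower b i := by
  classical
  rw [Finset.mul_sum, Finset.sum_mul, ← Finset.sum_sub_distrib, Finset.smul_sum]
  refine Finset.sum_congr rfl fun j _ => boxVec_hom_ext b fun q u => ?_
  simp only [LinearMap.sub_apply, Module.End.mul_apply, boxLower_boxVec, map_smul,
    LinearMap.smul_apply, sum_boxWeight_boxVec, smul_smul, ← sub_smul]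
  rcases Nat.eq_zero_or_pos (u j) with h | h
  · simp [h]
  · congr 1
    rw [mul_comm _ (∑ i, _), ← sub_mul, ← Finset.sum_sub_distrib]
    congr 1
    rw [Finset.sum_eq_single j]
    · simp [Nat.cast_sub (Nat.one_le_iff_ne_zero.2 h.ne')]
      ring
    · intro i _ hi
      simp [hi.symm]
    · simp

/-- If the boxes, placed in degrees shifted by `off`, have a common centre `D / 2`, then the sum of
the shift operators has the strong Lefschetz property. -/
theorem eq_zero_of_sum_boxRaise_pow_eq_zero [CharZero k] [Finite Q] (off : Q → ℕ) (D : ℕ)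
    (hD : ∀ q, D + Fintype.card σ = 2 * off q + ∑ i, sz q i) {i : ℕ} (hi : 2 * i ≤ D) {v : V}
    (hv : ∀ s : BoxIndex sz, off s.1.1 + s.1.2.degree ≠ i → b.repr v s = 0)
    (h : ((∑ j, boxRaise b j) ^ (D - 2 * i)) v = 0) : v = 0 := by
  have : FiniteDimensional k V := Module.Finite.of_basis b
  refine eq_zero_of_raising_pow_eq_zero (sum_boxRaise_boxLower b) (sum_boxWeight_boxRaise b)
    (sum_boxWeight_boxLower b) _ ?_ h
  have := Fintype.ofFinite (BoxIndex sz)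
  rw [← b.sum_repr v, map_sum, Finset.smul_sum]
  refine Finset.sum_congr rfl fun s _ => ?_
  by_cases hs : off s.1.1 + s.1.2.degree = i
  · rw [map_smul, ← boxVec_coe, sum_boxWeight_boxVec, smul_comm]
    congr 2
    -- The common centre `hD` makes the total weight in degree `i` equal to `2i - D` in every box.
    have h1 : ((D + Fintype.card σ : ℕ) : k) = (2 * off s.1.1 + ∑ i, sz s.1.1 i : ℕ) := by
      rw [hD s.1.1]
    have h2 : ((off s.1.1 + s.1.2.degree : ℕ) : k) = i := by rw [hs]
    rw [Finsupp.degree_eq_sum] at h2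
    push_cast [Nat.cast_sub hi] at h1 h2 ⊢
    simp only [Finset.sum_add_distrib, Finset.sum_sub_distrib, ← Finset.mul_sum, Finset.sum_const,
      Finset.card_univ, nsmul_eq_mul, mul_one]
    linear_combination 2 * h2 + h1
  · rw [hv s hs, zero_smul, map_zero, smul_zero]

end Box

/-! ### The monomial basis of the quotient and its duality. -/

section BinomialQuotient

open MvPolynomial Finsupp

variable {k : Type u} [Field k] {m : ℕ} (d α : Fin (m + 1) → ℕ) (c : k)

/-- The class of the monomial with exponent `v` in the quotient by `binomialIdeal d α c`. -/
noncomputable def mon (v : Fin (m + 1) →₀ ℕ) :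
    MvPolynomial (Fin (m + 1)) k ⧸ binomialIdeal d α c :=
  Ideal.Quotient.mk _ (monomial v 1)

lemma mon_add (v w : Fin (m + 1) →₀ ℕ) : mon d α c (v + w) = mon d α c v * mon d α c w := by
  simp [mon, ← map_mul, monomial_mul]

/-- The exponent of `x_2^{α_2} ⋯ x_n^{α_n}`. -/
noncomputable def tailExp : Fin (m + 1) →₀ ℕ :=
  Finsupp.equivFunOnFinite.symm (Fin.cons 0 fun j => α j.succ)

@[simp] lemma tailExp_zero : tailExp α 0 = 0 := rfl

@[simp] lemma tailExp_succ (j : Fin m) : tailExp α j.succ = α j.succ := rfl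

lemma degree_tailExp : (tailExp α).degree = ∑ j : Fin m, α j.succ := by
  simp [Finsupp.degree_eq_sum, Fin.sum_univ_succ]

lemma prod_X_pow_eq_monomial_tailExp :
    ∏ j : Fin m, (X j.succ : MvPolynomial (Fin (m + 1)) k) ^ α j.succ =
      monomial (tailExp α) 1 := by
  rw [monomial_eq, Finsupp.prod_fintype _ _ (by simp)]
  simp [Fin.prod_univ_succ]

/-- The generators of `binomialIdeal d α c`. -/
def binomialGens : Set (MvPolynomial (Fin (m + 1)) k) :=
  {monomial (single 0 (d 0)) 1 + C c * monomial (tailExp α) 1} ∪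
    (Set.range fun j : Fin m => monomial (single j.succ (d j.succ)) 1) ∪
    Set.range fun j : Fin m =>
      monomial (single 0 (d 0 - α 0) + single j.succ (d j.succ - α j.succ)) 1

lemma binomialIdeal_eq_span : binomialIdeal d α c = Ideal.span (binomialGens d α c) := by
  rw [binomialIdeal, binomialGens, Ideal.span_union (_ ∪ _), Ideal.span_mul_span', Set.singleton_mul,
    ← Set.range_comp, prod_X_pow_eq_monomial_tailExp]
  simp only [X_pow_eq_monomial, Function.comp_def, monomial_mul, mul_one]
  rfl

lemma mon_eq_zero_of_le {v : Fin (m + 1) →₀ ℕ} {j : Fin m} (h : d j.succ ≤ v j.succ) :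
    mon d α c v = 0 := by
  have hv : v = single j.succ (d j.succ) + (v - single j.succ (d j.succ)) :=
    (add_tsub_cancel_of_le (by simpa using h)).symm
  rw [hv, mon_add]
  convert zero_mul _
  rw [mon, Ideal.Quotient.eq_zero_iff_mem, binomialIdeal_eq_span]
  exact Ideal.subset_span (Or.inl (Or.inr ⟨j, rfl⟩))

lemma mon_eq_zero_of_le_of_le {v : Fin (m + 1) →₀ ℕ} {j : Fin m} (h0 : d 0 - α 0 ≤ v 0)
    (h : d j.succ - α j.succ ≤ v j.succ) : mon d α c v = 0 := by
  set g := single 0 (d 0 - α 0) + single j.succ (d j.succ - α j.succ)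
  have hv : v = g + (v - g) := by
    refine (add_tsub_cancel_of_le fun i => ?_).symm
    simp only [g, Finsupp.add_apply, single_apply]
    have := Fin.succ_ne_zero j
    grind
  rw [hv, mon_add]
  convert zero_mul _
  rw [mon, Ideal.Quotient.eq_zero_iff_mem, binomialIdeal_eq_span]
  exact Ideal.subset_span (Or.inr ⟨j, rfl⟩)

lemma mon_add_single_zero (v : Fin (m + 1) →₀ ℕ) :
    mon d α c (v + single 0 (d 0)) = (-c) • mon d α c (v + tailExp α) := by
  have h : mon d α c (single 0 (d 0)) = (-c) • mon d α c (tailExp α) := by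
    rw [neg_smul, eq_neg_iff_add_eq_zero, mon, mon, ← Ideal.Quotient.mkₐ_eq_mk k, ← map_smul,
      ← map_add, Ideal.Quotient.mkₐ_eq_mk, Ideal.Quotient.eq_zero_iff_mem, binomialIdeal_eq_span,
      smul_eq_C_mul]
    exact Ideal.subset_span (Or.inl (Or.inl rfl))
  rw [mon_add, h, mon_add, mul_smul_comm]

/-- The side lengths of the two boxes of exponents of a monomial basis of the quotient. -/
def boxSize (q : Bool) : Fin (m + 1) → ℕ :=
  Fin.cons (cond q (α 0) (d 0 - α 0)) fun j => cond q (d j.succ - α j.succ) (d j.succ)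

/-- The shift of the two boxes in the direction of the first variable. -/
def boxOffset (q : Bool) : ℕ := cond q (d 0 - α 0) 0

@[simp] lemma boxSize_false_zero : boxSize d α false 0 = d 0 - α 0 := rfl
@[simp] lemma boxSize_true_zero : boxSize d α true 0 = α 0 := rfl
@[simp] lemma boxSize_false_succ (j : Fin m) : boxSize d α false j.succ = d j.succ := rfl
@[simp] lemma boxSize_true_succ (j : Fin m) :
    boxSize d α true j.succ = d j.succ - α j.succ := rfl
@[simp] lemma boxOffset_false : boxOffset d α false = 0 := rfl
@[simp] lemma boxOffset_true : boxOffset d α true = d 0 - α 0 := rfl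

/-- The exponent of the basis monomial with a given index. -/
noncomputable def boxExp (s : BoxIndex (boxSize d α)) : Fin (m + 1) →₀ ℕ :=
  s.1.2 + single 0 (boxOffset d α s.1.1)

lemma degree_boxExp (s : BoxIndex (boxSize d α)) :
    (boxExp d α s).degree = boxOffset d α s.1.1 + s.1.2.degree := by
  rw [boxExp, map_add, degree_single, add_comm]

@[simp] lemma boxExp_zero (s : BoxIndex (boxSize d α)) :
    boxExp d α s 0 = s.1.2 0 + boxOffset d α s.1.1 := by simp [boxExp]

@[simp] lemma boxExp_succ (s : BoxIndex (boxSize d α)) (j : Fin m) :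
    boxExp d α s j.succ = s.1.2 j.succ := by simp [boxExp]

lemma boxIndex_eq_true_iff (s : BoxIndex (boxSize d α)) :
    s.1.1 = true ↔ d 0 - α 0 ≤ boxExp d α s 0 := by
  obtain ⟨⟨q, u⟩, h⟩ := s
  cases q
  · have := h 0
    simp only [boxSize_false_zero] at this
    simp
    omega
  · simp

lemma boxExp_injective : Function.Injective (boxExp d α) := by
  intro s t h
  have hq : s.1.1 = t.1.1 := by
    rw [Bool.eq_iff_iff, boxIndex_eq_true_iff, boxIndex_eq_true_iff, h]
  refine Subtype.ext (Prod.ext hq ?_)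
  rw [boxExp, boxExp, hq] at h
  exact add_right_cancel h

variable {d α} in
lemma boxExp_zero_lt (hα : ∀ i, α i ≤ d i) (s : BoxIndex (boxSize d α)) :
    boxExp d α s 0 < d 0 := by
  obtain ⟨⟨q, u⟩, h⟩ := s
  have := h 0
  have := hα 0
  cases q <;> simp at * <;> omega

variable {d α} in
-- Below `d 0`, the monomial generators kill exactly the exponents outside the two boxes.
lemma mon_eq_zero_or_exists_boxExp (hα : ∀ i, α i ≤ d i) {v : Fin (m + 1) →₀ ℕ}
    (hv : v 0 < d 0) : mon d α c v = 0 ∨ ∃ s, boxExp d α s = v := by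
  by_cases h0 : v 0 < d 0 - α 0
  · by_cases h : ∃ j : Fin m, d j.succ ≤ v j.succ
    · obtain ⟨j, hj⟩ := h
      exact Or.inl (mon_eq_zero_of_le d α c hj)
    · push Not at h
      refine Or.inr ⟨⟨(false, v), fun i => ?_⟩, by simp [boxExp]⟩
      refine Fin.cases ?_ (fun j => ?_) i
      · simpa using h0
      · simpa using h j
  · by_cases h : ∃ j : Fin m, d j.succ - α j.succ ≤ v j.succ
    · obtain ⟨j, hj⟩ := h
      exact Or.inl (mon_eq_zero_of_le_of_le d α c (not_lt.1 h0) hj)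
    · push Not at h
      refine Or.inr ⟨⟨(true, v - single 0 (d 0 - α 0)), fun i => ?_⟩, ?_⟩
      · have := hα 0
        refine Fin.cases ?_ (fun j => ?_) i
        · simp
          omega
        · simpa using h j
      · simp only [boxExp, boxOffset_true]
        exact tsub_add_cancel_of_le (by simpa using h0)

variable {d α} in
-- Each use of the binomial lowers the exponent of x_1 by `d 0 > 0` and, by `hd`, preserves the
-- degree.
lemma mon_mem_span (hα : ∀ i, α i ≤ d i) (hd : d 0 = ∑ j : Fin m, α j.succ) (hd0 : 0 < d 0)
    (v : Fin (m + 1) →₀ ℕ) :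
    mon d α c v ∈ Submodule.span k
      ((fun s => mon d α c (boxExp d α s)) '' {s | (boxExp d α s).degree = v.degree}) := by
  induction hn : v 0 using Nat.strong_induction_on generalizing v with
  | _ n ih =>
    by_cases hv : v 0 < d 0
    · rcases mon_eq_zero_or_exists_boxExp c hα hv with h | ⟨s, rfl⟩
      · rw [h]; exact zero_mem _
      · exact Submodule.subset_span ⟨s, rfl, rfl⟩
    · obtain ⟨v', rfl⟩ : ∃ v', v = v' + single 0 (d 0) :=
        ⟨v - single 0 (d 0), (tsub_add_cancel_of_le (by simpa using hv)).symm⟩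
      rw [mon_add_single_zero]
      refine Submodule.smul_mem _ _ ?_
      have := ih ((v' + tailExp α) 0) (by simp at hn ⊢; omega) _ rfl
      rwa [map_add, degree_tailExp, ← hd, ← degree_single (0 : Fin (m + 1)) (d 0),
        ← map_add] at this

/-! ### The dual functional. -/

section Functional

open Classical in
/-- The coefficient of the monomial with exponent `v` in the functional spanning the inverse system
of `binomialIdeal d α c`. -/
noncomputable def socleCoeff (v : Fin (m + 1) →₀ ℕ) : k :=
  if h : ∃ q : ℕ, v 0 + 1 = d 0 - α 0 + q * d 0 ∧ ∀ j : Fin m, v j.succ + 1 + q * α j.succ = d j.succ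
  then (-c) ^ h.choose else 0

variable {d} in
lemma socleCoeff_eq_pow (hd0 : 0 < d 0) {v : Fin (m + 1) →₀ ℕ} {q : ℕ}
    (h0 : v 0 + 1 = d 0 - α 0 + q * d 0)
    (h : ∀ j : Fin m, v j.succ + 1 + q * α j.succ = d j.succ) :
    socleCoeff d α c v = (-c) ^ q := by
  have H : ∃ q : ℕ, v 0 + 1 = d 0 - α 0 + q * d 0 ∧
      ∀ j : Fin m, v j.succ + 1 + q * α j.succ = d j.succ := ⟨q, h0, h⟩
  rw [socleCoeff, dif_pos H]
  congr 1
  have := H.choose_spec.1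
  exact Nat.eq_of_mul_eq_mul_right hd0 (by omega)

lemma socleCoeff_eq_zero {v : Fin (m + 1) →₀ ℕ}
    (h : ∀ q : ℕ, v 0 + 1 = d 0 - α 0 + q * d 0 →
      ¬ ∀ j : Fin m, v j.succ + 1 + q * α j.succ = d j.succ) :
    socleCoeff d α c v = 0 :=
  dif_neg fun ⟨q, h0, h1⟩ => h q h0 h1

lemma socleCoeff_eq_zero_of_le {v : Fin (m + 1) →₀ ℕ} {j : Fin m} (h : d j.succ ≤ v j.succ) :
    socleCoeff d α c v = 0 :=
  socleCoeff_eq_zero d α c fun q _ h' => by have := h' j; omega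

/-- The bound on `v 0` excludes `q = 0`, and the bound on `v j.succ` excludes `q ≥ 1`. -/
lemma socleCoeff_eq_zero_of_le_of_le {v : Fin (m + 1) →₀ ℕ} {j : Fin m} (h0 : d 0 - α 0 ≤ v 0)
    (h : d j.succ - α j.succ ≤ v j.succ) : socleCoeff d α c v = 0 :=
  socleCoeff_eq_zero d α c fun q hq h' => by
    have := h' j
    rcases q with _ | q
    · omega
    · rw [add_mul] at this
      omega

variable {d} in
-- Trading `tailExp α` for `d 0` copies of x_1 raises `q` by one, hence the factor `-c`. The value
-- `q = 0` cannot occur on the left, where the exponent of x_1 is at least `d 0`.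
lemma socleCoeff_add_single (hd0 : 0 < d 0) (v : Fin (m + 1) →₀ ℕ) :
    socleCoeff d α c (v + single 0 (d 0)) = -c * socleCoeff d α c (v + tailExp α) := by
  by_cases H : ∃ q : ℕ, v 0 + 1 = d 0 - α 0 + q * d 0 ∧
      ∀ j : Fin m, v j.succ + α j.succ + 1 + q * α j.succ = d j.succ
  · obtain ⟨q, h0, h⟩ := H
    rw [socleCoeff_eq_pow (v := v + tailExp α) (q := q) α c hd0 (by simpa using h0)
      (by simpa using h), socleCoeff_eq_pow (q := q + 1) α c hd0, pow_succ']
    · simp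
      linarith
    · intro j
      have := h j
      simp
      linarith
  · rw [socleCoeff_eq_zero d α c (v := v + tailExp α), mul_zero, socleCoeff_eq_zero]
    · intro q hq hj
      rcases q with _ | q
      · simp at hq
        omega
      · refine H ⟨q, ?_, fun j => ?_⟩
        · simp at hq
          linarith
        · have := hj j
          simp at this
          linarith
    · intro q hq hj
      exact H ⟨q, by simpa using hq, by simpa using hj⟩

/-- The functional on the polynomial ring with coefficients `socleCoeff d α c`. -/
noncomputable def socleFunctional : MvPolynomial (Fin (m + 1)) k →ₗ[k] k :=
  (basisMonomials (Fin (m + 1)) k).constr k (socleCoeff d α c)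

lemma socleFunctional_monomial (v : Fin (m + 1) →₀ ℕ) :
    socleFunctional d α c (monomial v 1) = socleCoeff d α c v := by
  have h := (basisMonomials (Fin (m + 1)) k).constr_basis k (socleCoeff d α c) v
  rwa [coe_basisMonomials] at h

lemma linearMap_eq_zero_of_mem_span {σ : Type*} (φ : MvPolynomial σ k →ₗ[k] k)
    {G : Set (MvPolynomial σ k)} (h : ∀ g ∈ G, ∀ v, φ (monomial v 1 * g) = 0)
    {f : MvPolynomial σ k} (hf : f ∈ Ideal.span G) : φ f = 0 := by
  have h' : ∀ g ∈ G, ∀ a, φ (a * g) = 0 := by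
    intro g hg a
    have : φ ∘ₗ LinearMap.mulRight k g = 0 :=
      (basisMonomials σ k).ext fun v => by simpa using h g hg v
    exact LinearMap.congr_fun this a
  induction hf using Submodule.span_induction with
  | mem x hx => simpa using h' x hx 1
  | zero => simp
  | add x y _ _ hx hy => rw [map_add, hx, hy, add_zero]
  | smul a x hx _ =>
    refine Submodule.span_induction (p := fun x _ => ∀ a, φ (a * x) = 0) (fun x hx => h' x hx) ?_ ?_
      ?_ hx a
    · simp
    · intro x y _ _ hx hy a
      rw [mul_add, map_add, hx, hy, add_zero]
    · intro b x _ hx a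
      rw [smul_eq_mul, ← mul_assoc, hx]

variable {d} in
lemma socleFunctional_eq_zero (hd0 : 0 < d 0) {f : MvPolynomial (Fin (m + 1)) k}
    (hf : f ∈ binomialIdeal d α c) : socleFunctional d α c f = 0 := by
  rw [binomialIdeal_eq_span] at hf
  refine linearMap_eq_zero_of_mem_span _ ?_ hf
  rintro g ((rfl | ⟨j, rfl⟩) | ⟨j, rfl⟩) v
  · rw [← smul_eq_C_mul, mul_add, mul_smul_comm, monomial_mul, monomial_mul, mul_one, map_add,
      map_smul, socleFunctional_monomial, socleFunctional_monomial, socleCoeff_add_single α c hd0,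
      smul_eq_mul]
    ring
  · simp only [monomial_mul, mul_one, socleFunctional_monomial]
    exact socleCoeff_eq_zero_of_le d α c (j := j) (by simp)
  · simp only [monomial_mul, mul_one, socleFunctional_monomial]
    exact socleCoeff_eq_zero_of_le_of_le d α c (j := j) (by simp) (by simp)

variable {d α} in
lemma exists_functional (hd0 : 0 < d 0) :
    ∃ φ : (MvPolynomial (Fin (m + 1)) k ⧸ binomialIdeal d α c) →ₗ[k] k,
      ∀ v, φ (mon d α c v) = socleCoeff d α c v := by
  refine ⟨(((binomialIdeal d α c).restrictScalars k).liftQ (socleFunctional d α c)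
    fun f hf => socleFunctional_eq_zero α c hd0 hf) ∘ₗ
    (Submodule.Quotient.restrictScalarsEquiv k (binomialIdeal d α c)).symm.toLinearMap,
    fun v => ?_⟩
  rw [← socleFunctional_monomial]
  rfl

end Functional

/-- The involution of the index set reversing each box. -/
noncomputable def boxRev (s : BoxIndex (boxSize d α)) : BoxIndex (boxSize d α) :=
  ⟨(s.1.1, Finsupp.equivFunOnFinite.symm fun i => boxSize d α s.1.1 i - 1 - s.1.2 i), fun i => by
    have := s.2 i
    simp only [Finsupp.equivFunOnFinite_symm_apply_apply]
    omega⟩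

@[simp] lemma boxRev_fst (s : BoxIndex (boxSize d α)) : (boxRev d α s).1.1 = s.1.1 := rfl

@[simp] lemma boxRev_snd (s : BoxIndex (boxSize d α)) (i : Fin (m + 1)) :
    (boxRev d α s).1.2 i = boxSize d α s.1.1 i - 1 - s.1.2 i := rfl

lemma boxRev_involutive : Function.Involutive (boxRev d α) := by
  intro s
  refine Subtype.ext (Prod.ext rfl ?_)
  ext i
  have := s.2 i
  simp only [boxRev_snd, boxRev_fst]
  omega

variable {d α} in
-- Mirror exponents in the first box add up to the support point with `q = 0`, in the second to that
-- with `q = 1`.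
lemma socleCoeff_boxExp_add_boxExp_boxRev_self (hα : ∀ i, α i ≤ d i) (hd0 : 0 < d 0)
    (s : BoxIndex (boxSize d α)) :
    socleCoeff d α c (boxExp d α s + boxExp d α (boxRev d α s)) = (-c) ^ s.1.1.toNat := by
  apply socleCoeff_eq_pow α c hd0
  · have := hα 0
    have := s.2 0
    simp only [Finsupp.add_apply, boxExp_zero, boxRev_snd, boxRev_fst]
    obtain ⟨⟨q, u⟩, h⟩ := s
    cases q <;> simp at * <;> omega
  · intro j
    have := hα j.succ
    have := s.2 j.succ
    simp only [Finsupp.add_apply, boxExp_succ, boxRev_snd]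
    obtain ⟨⟨q, u⟩, h⟩ := s
    cases q <;> simp at * <;> omega

variable {d α} in
-- On the support, the x_1-exponents of `s` and `t` agree modulo `d 0`. Both are below `d 0`, so
-- they coincide; this fixes `q`, and then the other exponents coincide too.
lemma socleCoeff_boxExp_add_boxExp_boxRev_of_ne (hα : ∀ i, α i ≤ d i)
    {s t : BoxIndex (boxSize d α)} (hst : s ≠ t) :
    socleCoeff d α c (boxExp d α s + boxExp d α (boxRev d α t)) = 0 := by
  refine socleCoeff_eq_zero d α c fun q h0 h => hst (boxExp_injective d α ?_)
  have hs := boxExp_zero_lt hα s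
  have ht := boxExp_zero_lt hα t
  have h0' : boxExp d α s 0 + t.1.1.toNat * d 0 = boxExp d α t 0 + q * d 0 := by
    have := hα 0
    have := t.2 0
    rw [Finsupp.add_apply, boxExp_zero _ _ (boxRev d α t), boxRev_snd, boxRev_fst] at h0
    rw [boxExp_zero _ _ t]
    obtain ⟨⟨q, u⟩, h⟩ := t
    cases q <;> simp at * <;> omega
  have hq : q = t.1.1.toNat := by
    rcases lt_trichotomy q t.1.1.toNat with h | h | h
    · nlinarith
    · exact h
    · nlinarith
  subst hq
  ext i
  refine Fin.cases (by omega) (fun j => ?_) i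
  have h1 := h j
  have := hα j.succ
  have := t.2 j.succ
  rw [Finsupp.add_apply, boxExp_succ _ _ (boxRev d α t), boxRev_snd] at h1
  rw [boxExp_succ _ _ t]
  obtain ⟨⟨q, u⟩, h⟩ := t
  cases q <;> simp at * <;> omega

variable {d α} in
/-- The dual basis property of the monomials under the functional. -/
lemma exists_functional_nondegenerate (hα : ∀ i, α i ≤ d i) (hd0 : 0 < d 0) :
    ∃ φ : (MvPolynomial (Fin (m + 1)) k ⧸ binomialIdeal d α c) →ₗ[k] k,
      ∀ (l : BoxIndex (boxSize d α) →₀ k) t,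
        φ (Finsupp.linearCombination k (fun s => mon d α c (boxExp d α s)) l *
          mon d α c (boxExp d α (boxRev d α t))) = l t * (-c) ^ t.1.1.toNat := by
  obtain ⟨φ, hφ⟩ := exists_functional c hd0
  refine ⟨φ, fun l t => ?_⟩
  rw [Finsupp.linearCombination_apply, Finsupp.sum, Finset.sum_mul, map_sum,
    Finset.sum_eq_single t]
  · rw [smul_mul_assoc, map_smul, ← mon_add, hφ, socleCoeff_boxExp_add_boxExp_boxRev_self c hα hd0,
      smul_eq_mul]
  · intro s _ hs
    rw [smul_mul_assoc, map_smul, ← mon_add, hφ, socleCoeff_boxExp_add_boxExp_boxRev_of_ne c hα hs,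
      smul_zero]
  · intro ht
    rw [Finsupp.notMem_support_iff.1 ht]
    simp

variable {d α c} in
lemma linearIndependent_mon_boxExp (hα : ∀ i, α i ≤ d i) (hd0 : 0 < d 0) (hc : c ≠ 0) :
    LinearIndependent k fun s => mon d α c (boxExp d α s) := by
  rw [linearIndependent_iff]
  intro l hl
  obtain ⟨φ, hφ⟩ := exists_functional_nondegenerate c hα hd0
  ext t
  have := hφ l t
  rw [hl, zero_mul, map_zero] at this
  simpa [hc] using this.symm

variable {d α c} in
lemma top_le_span_mon_boxExp (hα : ∀ i, α i ≤ d i) (hd : d 0 = ∑ j : Fin m, α j.succ)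
    (hd0 : 0 < d 0) : ⊤ ≤ Submodule.span k (Set.range fun s => mon d α c (boxExp d α s)) := by
  rintro x -
  obtain ⟨f, rfl⟩ := Ideal.Quotient.mk_surjective x
  induction f using MvPolynomial.induction_on' with
  | monomial v a =>
    rw [← mul_one a, ← smul_eq_mul, ← smul_monomial, ← Ideal.Quotient.mkₐ_eq_mk k, map_smul]
    exact Submodule.smul_mem _ _ (Submodule.span_mono (Set.image_subset_range _ _)
      (mon_mem_span c hα hd hd0 v))
  | add p q hp hq => rw [map_add]; exact add_mem hp hq

variable {d α c} in
/-- The monomial basis of the quotient by `binomialIdeal d α c`. -/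
noncomputable def monBasis (hα : ∀ i, α i ≤ d i) (hd : d 0 = ∑ j : Fin m, α j.succ)
    (hd0 : 0 < d 0) (hc : c ≠ 0) :
    Module.Basis (BoxIndex (boxSize d α)) k
      (MvPolynomial (Fin (m + 1)) k ⧸ binomialIdeal d α c) :=
  Module.Basis.mk (linearIndependent_mon_boxExp hα hd0 hc) (top_le_span_mon_boxExp hα hd hd0)

/-! ### Multiplication by the variables in the monomial basis. -/

section Basis

variable {d α c} (hα : ∀ i, α i ≤ d i) (hd : d 0 = ∑ j : Fin m, α j.succ)
    (hd0 : 0 < d 0) (hc : c ≠ 0)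

lemma monBasis_apply (s : BoxIndex (boxSize d α)) :
    monBasis hα hd hd0 hc s = mon d α c (boxExp d α s) := by
  rw [monBasis, Module.Basis.mk_apply]

include hα hd hd0 hc in
theorem isGorensteinRing_quotient_binomialIdeal :
    IsGorensteinRing (MvPolynomial (Fin (m + 1)) k ⧸ binomialIdeal d α c) := by
  obtain ⟨φ, hφ⟩ := exists_functional_nondegenerate c hα hd0
  let b := monBasis hα hd hd0 hc
  have := Module.Finite.of_basis b
  refine isGorensteinRing_of_nondegenerate φ fun a ha => ?_
  have hb : (fun s => mon d α c (boxExp d α s)) = b :=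
    funext fun s => (monBasis_apply hα hd hd0 hc s).symm
  rw [← b.repr.map_eq_zero_iff]
  ext t
  have := hφ (b.repr a) t
  rw [hb, b.linearCombination_repr, ha] at this
  simpa [hc] using this.symm

lemma mem_quotientComponent_iff (i : ℕ)
    (a : MvPolynomial (Fin (m + 1)) k ⧸ binomialIdeal d α c) :
    a ∈ quotientComponent (binomialIdeal d α c) i ↔
      ∀ s, (boxExp d α s).degree ≠ i → (monBasis hα hd hd0 hc).repr a s = 0 := by
  set b := monBasis hα hd hd0 hc
  have hb : (fun s => mon d α c (boxExp d α s)) = b :=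
    funext fun s => (monBasis_apply hα hd hd0 hc s).symm
  constructor
  · rintro ⟨f, hf, rfl⟩ s hs
    have hf' : f.IsHomogeneous i := hf
    have key : (Ideal.Quotient.mkₐ k (binomialIdeal d α c)).toLinearMap f ∈
        Submodule.span k (b '' {s | (boxExp d α s).degree = i}) := by
      rw [f.as_sum, map_sum]
      refine Submodule.sum_mem _ fun v hv => ?_
      rw [← mul_one (coeff v f), ← smul_eq_mul, ← smul_monomial, map_smul]
      have hvi : v.degree = i := by
        by_contra h
        exact (MvPolynomial.mem_support_iff.1 hv) (hf'.coeff_eq_zero h)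
      have := mon_mem_span c hα hd hd0 v
      rw [hvi, hb] at this
      exact Submodule.smul_mem _ _ this
    rw [b.mem_span_image] at key
    by_contra h
    exact hs (key (by simpa using h))
  · intro h
    have := Fintype.ofFinite (BoxIndex (boxSize d α))
    rw [← b.sum_repr a]
    refine Submodule.sum_mem _ fun s _ => ?_
    by_cases hs : (boxExp d α s).degree = i
    · refine Submodule.smul_mem _ _ ⟨monomial (boxExp d α s) 1, ?_, ?_⟩
      · exact isHomogeneous_monomial _ hs
      · exact (monBasis_apply hα hd hd0 hc s).symm
    · rw [h s hs, zero_smul]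
      exact zero_mem _

/-- Leaving the first box in direction `j` meets the pure power generator; leaving the second meets
the mixed one. So these variables act exactly by shifts. -/
lemma mon_single_succ_mul_monBasis (s : BoxIndex (boxSize d α)) (j : Fin m) :
    mon d α c (single j.succ 1) * monBasis hα hd hd0 hc s =
      boxVec (monBasis hα hd hd0 hc) s.1.1 (s.1.2 + single j.succ 1) := by
  rw [monBasis_apply, ← mon_add]
  by_cases h : ∀ i, (s.1.2 + single j.succ 1 : Fin (m + 1) →₀ ℕ) i < boxSize d α s.1.1 i
  · rw [boxVec_of_lt _ h, monBasis_apply]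
    congr 1
    simp only [boxExp]
    abel
  · have h' : boxSize d α s.1.1 j.succ ≤ s.1.2 j.succ + 1 := by
      push Not at h
      obtain ⟨i, hi⟩ := h
      have := s.2 i
      by_cases hij : i = j.succ
      · subst hij
        simpa using hi
      · simp [Ne.symm hij] at hi
        omega
    rw [boxVec_of_le _ (i := j.succ) (by simpa using h')]
    obtain ⟨⟨q, u⟩, hu⟩ := s
    cases q
    · apply mon_eq_zero_of_le d α c (j := j)
      simp at h' ⊢
      omega
    · apply mon_eq_zero_of_le_of_le d α c (j := j)
      · simp
      · simp at h' ⊢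
        omega

/-- The weight of a basis monomial, by which multiplication by the first variable is
degenerated. -/
noncomputable def boxHeight (s : BoxIndex (boxSize d α)) : ℕ :=
  2 * boxExp d α s 0 + cond s.1.1 0 1

/-- A step inside a box raises the height by 2. Crossing from the first box to the second raises it
by only 1, thanks to the extra 1 in the first box, and wrapping around by the binomial lands at
height at most 1. The last two are thus lower-order terms, lost in the degeneration. -/
lemma mon_single_zero_mul_monBasis (s : BoxIndex (boxSize d α)) :
    (∃ t : BoxIndex (boxSize d α), t.1 = (s.1.1, s.1.2 + single 0 1) ∧
      mon d α c (single 0 1) * monBasis hα hd hd0 hc s = monBasis hα hd hd0 hc t) ∨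
    (boxSize d α s.1.1 0 ≤ s.1.2 0 + 1 ∧
      (mon d α c (single 0 1) * monBasis hα hd hd0 hc s = 0 ∨
      ∃ (t : BoxIndex (boxSize d α)) (r : k), boxHeight t < boxHeight s + 2 ∧
        mon d α c (single 0 1) * monBasis hα hd hd0 hc s = r • monBasis hα hd hd0 hc t)) := by
  simp only [monBasis_apply]
  rw [← mon_add]
  by_cases h : s.1.2 0 + 1 < boxSize d α s.1.1 0
  · refine Or.inl ⟨⟨(s.1.1, s.1.2 + single 0 1), fun i => ?_⟩, rfl, ?_⟩
    · have := s.2 i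
      refine Fin.cases (fun h' => by simpa using h) (fun j h' => by simpa using h') i this
    · congr 1
      simp only [boxExp]
      abel
  refine Or.inr ⟨not_lt.1 h, ?_⟩
  have hlt := boxExp_zero_lt hα s
  by_cases hlt' : boxExp d α s 0 + 1 < d 0
  · rcases mon_eq_zero_or_exists_boxExp c hα (v := single 0 1 + boxExp d α s)
      (by simp only [Finsupp.add_apply, single_eq_same]; omega) with h' | ⟨t, ht⟩
    · exact Or.inl h'
    · refine Or.inr ⟨t, 1, ?_, by rw [ht, one_smul]⟩
      have h1 := (boxIndex_eq_true_iff d α t)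
      have h2 := (boxIndex_eq_true_iff d α s)
      have h3 : boxExp d α t 0 = boxExp d α s 0 + 1 := by
        rw [ht, Finsupp.add_apply, single_eq_same, add_comm]
      have h4 : s.1.1 = false := by
        by_contra hs
        have := hα 0
        rw [Bool.not_eq_false] at hs
        rw [boxExp_zero, hs, boxOffset_true] at hlt'
        rw [hs, boxSize_true_zero] at h
        omega
      have h5 : t.1.1 = true := by
        rw [h1, h3, boxExp_zero, h4, boxOffset_false]
        rw [h4, boxSize_false_zero] at h
        omega
      simp only [boxHeight, h3, h4, h5, cond_true, cond_false]
      omega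
  · obtain ⟨v, hv⟩ : ∃ v, single 0 1 + boxExp d α s = v + single 0 (d 0) := by
      refine ⟨single 0 1 + boxExp d α s - single 0 (d 0), (tsub_add_cancel_of_le ?_).symm⟩
      rw [single_le_iff, Finsupp.add_apply, single_eq_same]
      omega
    have hv0 : (v + tailExp α) 0 = 0 := by
      have := DFunLike.congr_fun hv 0
      simp only [Finsupp.add_apply, single_eq_same, tailExp_zero] at this ⊢
      omega
    rw [hv, mon_add_single_zero]
    rcases mon_eq_zero_or_exists_boxExp c hα (v := v + tailExp α) (by omega) with h' | ⟨t, ht⟩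
    · exact Or.inl (by rw [h', smul_zero])
    · refine Or.inr ⟨t, -c, ?_, by rw [ht]⟩
      have h1 : boxHeight t ≤ 1 := by
        rw [boxHeight, ht, hv0]
        cases t.1.1 <;> simp
      omega

end Basis

end BinomialQuotient

/-! ### The strong Lefschetz property. -/

section Lefschetz

open MvPolynomial Finsupp

lemma eq_of_repr_boxVec_ne_zero {k V Q σ : Type*} [Field k] [AddCommGroup V] [Module k V]
    {sz : Q → σ → ℕ} (b : Module.Basis (BoxIndex sz) k V) {q : Q} {u : σ →₀ ℕ}
    {t : BoxIndex sz} (h : b.repr (boxVec b q u) t ≠ 0) : t.1 = (q, u) := by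
  classical
  by_cases hu : ∀ i, u i < sz q i
  · rw [boxVec_of_lt b hu, b.repr_self, single_apply_ne_zero] at h
    rw [h.1]
  · simp [boxVec, hu] at h

lemma mul_mem_quotientComponent {σ k : Type*} [Field k] {I : Ideal (MvPolynomial σ k)} {i j : ℕ}
    {a b : MvPolynomial σ k ⧸ I} (ha : a ∈ quotientComponent I i)
    (hb : b ∈ quotientComponent I j) : a * b ∈ quotientComponent I (i + j) := by
  obtain ⟨f, hf, rfl⟩ := ha
  obtain ⟨g, hg, rfl⟩ := hb
  exact ⟨f * g, IsHomogeneous.mul hf hg, map_mul (Ideal.Quotient.mkₐ k I) f g⟩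

lemma pow_mul_mem_quotientComponent {σ k : Type*} [Field k] {I : Ideal (MvPolynomial σ k)}
    {i : ℕ} {l a : MvPolynomial σ k ⧸ I} (hl : l ∈ quotientComponent I 1)
    (ha : a ∈ quotientComponent I i) (e : ℕ) : l ^ e * a ∈ quotientComponent I (i + e) := by
  induction e with
  | zero => simpa using ha
  | succ e ih =>
    rw [pow_succ', mul_assoc, ← add_assoc, add_comm _ 1]
    exact mul_mem_quotientComponent hl ih

/-- The strong Lefschetz property follows from its narrow form: bijectivity of the multiplication
maps between components symmetric about `D / 2`. -/
lemma maximal_rank_of_narrow {σ k : Type*} [Field k] {I : Ideal (MvPolynomial σ k)} {D : ℕ}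
    {l : MvPolynomial σ k ⧸ I} (hl : l ∈ quotientComponent I 1)
    (hD : ∀ i, D < i → quotientComponent I i = ⊥)
    (hinj : ∀ i, 2 * i ≤ D → ∀ a ∈ quotientComponent I i, l ^ (D - 2 * i) * a = 0 → a = 0)
    (hsurj : ∀ i, 2 * i ≤ D →
      Set.SurjOn (fun a => l ^ (D - 2 * i) * a) (quotientComponent I i)
        (quotientComponent I (D - i))) (e i : ℕ) :
    Set.InjOn (fun a => l ^ e * a) (quotientComponent I i) ∨
      Set.SurjOn (fun a => l ^ e * a) (quotientComponent I i) (quotientComponent I (i + e)) := by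
  by_cases h1 : 2 * i + e ≤ D
  · left
    intro a ha a' ha' h
    rw [← sub_eq_zero]
    refine hinj i (by omega) _ (sub_mem ha ha') ?_
    have h2 : l ^ e * (a - a') = 0 := by rw [mul_sub, sub_eq_zero]; exact h
    rw [show D - 2 * i = (D - 2 * i - e) + e by omega, pow_add, mul_assoc, h2, mul_zero]
  · right
    by_cases h2 : D < i + e
    · intro y hy
      rw [SetLike.mem_coe, hD _ h2, Submodule.mem_bot] at hy
      exact ⟨0, zero_mem _, by simp [hy]⟩
    · intro y hy
      have hi' : D - (D - (i + e)) = i + e := by omega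
      -- Here `D - (i + e) < i`, so the symmetric surjection onto degree `i + e` factors through
      -- degree `i`.
      obtain ⟨x, hx, rfl⟩ := hsurj (D - (i + e)) (by omega) (by rwa [hi'])
      refine ⟨l ^ (i - (D - (i + e))) * x, ?_, ?_⟩
      · have := pow_mul_mem_quotientComponent hl hx (i - (D - (i + e)))
        rwa [show D - (i + e) + (i - (D - (i + e))) = i by omega] at this
      · dsimp only
        rw [← mul_assoc, ← pow_add]
        congr 2
        omega

variable {k : Type u} [Field k] {m : ℕ} {d α : Fin (m + 1) → ℕ} {c : k}

lemma isHomogeneous_binomialIdeal (hd : d 0 = ∑ j : Fin m, α j.succ) :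
    (binomialIdeal d α c).IsHomogeneous (homogeneousSubmodule (Fin (m + 1)) k) := by
  rw [binomialIdeal_eq_span]
  refine Ideal.homogeneous_span _ _ ?_
  rintro g ((rfl | ⟨j, rfl⟩) | ⟨j, rfl⟩)
  · refine ⟨d 0, IsHomogeneous.add (isHomogeneous_monomial _ (degree_single _ _))
      (IsHomogeneous.C_mul (isHomogeneous_monomial _ ?_) _)⟩
    rw [degree_tailExp, hd]
  · exact ⟨_, isHomogeneous_monomial _ rfl⟩
  · exact ⟨_, isHomogeneous_monomial _ rfl⟩

lemma mon_mem_quotientComponent (v : Fin (m + 1) →₀ ℕ) :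
    mon d α c v ∈ quotientComponent (binomialIdeal d α c) v.degree :=
  ⟨monomial v 1, isHomogeneous_monomial _ rfl, rfl⟩

/-- The socle degree of the quotient by `binomialIdeal d α c`. -/
def socleDegree (d α : Fin (m + 1) → ℕ) : ℕ := d 0 - α 0 + ∑ j : Fin m, d j.succ - (m + 1)

variable (hα : ∀ i, α i ≤ d i) (hd : d 0 = ∑ j : Fin m, α j.succ) (hd0 : 0 < d 0) (hc : c ≠ 0)

include hd hα hd0 in
-- Passing to the second box changes the right side by `d 0 - ∑ α j.succ`, which is zero: the boxes
-- are concentric. Properness of the ideal ensures that the subtraction in `socleDegree` does not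
-- truncate.
lemma socleDegree_add (hK : binomialIdeal d α c ≠ ⊤) (q : Bool) :
    socleDegree d α + Fintype.card (Fin (m + 1)) =
      2 * boxOffset d α q + ∑ i, boxSize d α q i := by
  have h1 : mon d α c 0 ≠ 0 := by
    rw [mon, Ne, Ideal.Quotient.eq_zero_iff_mem]
    exact fun h => hK ((Ideal.eq_top_iff_one _).2 h)
  have hpos : ∀ j : Fin m, 1 ≤ d j.succ := fun j => by
    by_contra h
    exact h1 (mon_eq_zero_of_le d α c (j := j) (by simp; omega))
  have hle : m + 1 ≤ d 0 - α 0 + ∑ j : Fin m, d j.succ := by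
    by_cases hp : d 0 - α 0 = 0
    · have h2 : ∑ j : Fin m, (α j.succ + 1) ≤ ∑ j : Fin m, d j.succ :=
        Finset.sum_le_sum fun j _ => by
          by_contra h
          exact h1 (mon_eq_zero_of_le_of_le d α c (j := j) (by simp; omega) (by simp; omega))
      simp [Finset.sum_add_distrib] at h2
      omega
    · have h2 : ∑ j : Fin m, 1 ≤ ∑ j : Fin m, d j.succ := Finset.sum_le_sum fun j _ => hpos j
      simp at h2
      omega
  have h3 : ∑ j : Fin m, (d j.succ - α j.succ) + ∑ j : Fin m, α j.succ = ∑ j : Fin m, d j.succ := by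
    rw [← Finset.sum_add_distrib]
    exact Finset.sum_congr rfl fun j _ => Nat.sub_add_cancel (hα _)
  have := hα 0
  rw [socleDegree, Fintype.card_fin, Fin.sum_univ_succ]
  cases q <;> simp <;> omega

/-- Reversing the boxes exchanges the degrees `i` and
`D - i`. -/
lemma degree_boxExp_boxRev {D : ℕ}
    (hD : ∀ q, D + Fintype.card (Fin (m + 1)) = 2 * boxOffset d α q + ∑ i, boxSize d α q i)
    (s : BoxIndex (boxSize d α)) :
    (boxExp d α (boxRev d α s)).degree + (boxExp d α s).degree = D := by
  rw [degree_boxExp, degree_boxExp, boxRev_fst, Finsupp.degree_eq_sum, Finsupp.degree_eq_sum]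
  have h1 : ∑ i, (boxRev d α s).1.2 i + ∑ i, s.1.2 i + ∑ i : Fin (m + 1), 1 =
      ∑ i, boxSize d α s.1.1 i := by
    rw [← Finset.sum_add_distrib, ← Finset.sum_add_distrib]
    refine Finset.sum_congr rfl fun i _ => ?_
    have := s.2 i
    rw [boxRev_snd]
    omega
  have h2 := hD s.1.1
  simp only [Finset.sum_const, Finset.card_univ, smul_eq_mul, mul_one] at h1
  omega

include hα hd hd0 hc in
-- Reversing the boxes permutes the basis and carries degree `D - i` into degree `i`.
lemma finrank_quotientComponent_le {D : ℕ}
    (hD : ∀ q, D + Fintype.card (Fin (m + 1)) = 2 * boxOffset d α q + ∑ i, boxSize d α q i)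
    {i : ℕ} (hi : i ≤ D) :
    Module.finrank k (quotientComponent (binomialIdeal d α c) (D - i)) ≤
      Module.finrank k (quotientComponent (binomialIdeal d α c) i) := by
  let b := monBasis hα hd hd0 hc
  have := Module.Finite.of_basis b
  let G := b.repr ≪≫ₗ Finsupp.domLCongr (boxRev_involutive d α).toPerm ≪≫ₗ b.repr.symm
  have hG : ∀ a ∈ quotientComponent (binomialIdeal d α c) (D - i),
      G.toLinearMap a ∈ quotientComponent (binomialIdeal d α c) i := by
    intro a ha
    rw [mem_quotientComponent_iff hα hd hd0 hc] at ha ⊢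
    intro s hs
    have h1 : b.repr (G a) s = b.repr a (boxRev d α s) := by
      simp only [G, LinearEquiv.trans_apply, LinearEquiv.apply_symm_apply, domLCongr_apply,
        domCongr_apply, equivMapDomain_apply, Function.Involutive.toPerm_symm,
        Function.Involutive.coe_toPerm]
    refine h1.trans (ha _ fun h => hs ?_)
    have := degree_boxExp_boxRev hD s
    omega
  refine LinearMap.finrank_le_finrank_of_injective (f := G.toLinearMap.restrict hG) ?_
  intro x y hxy
  exact Subtype.ext (G.injective (congrArg Subtype.val hxy))

/-- Identifies the sum of shifts as the top-height part of multiplication by the variables, as the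
deformation argument requires. -/
lemma repr_sum_boxRaise_monBasis (s t : BoxIndex (boxSize d α)) :
    (monBasis hα hd hd0 hc).repr
        ((∑ i, boxRaise (monBasis hα hd hd0 hc) i) (monBasis hα hd hd0 hc s)) t =
      (monBasis hα hd hd0 hc).repr
          ((∑ j : Fin m, mon d α c (single j.succ 1)) * monBasis hα hd hd0 hc s) t +
        if boxHeight t = boxHeight s + 2 then
          (monBasis hα hd hd0 hc).repr (mon d α c (single 0 1) * monBasis hα hd hd0 hc s) t
        else 0 := by
  classical
  have hr (i) : boxRaise (monBasis hα hd hd0 hc) i (monBasis hα hd hd0 hc s) =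
      boxVec (monBasis hα hd hd0 hc) s.1.1 (s.1.2 + single i 1) := by
    rw [← boxRaise_boxVec, boxVec_coe]
  rw [LinearMap.sum_apply, Fin.sum_univ_succ, Finset.sum_mul,
    add_comm (boxRaise (monBasis hα hd hd0 hc) 0 _), map_add,
    Finsupp.add_apply]
  simp only [hr, mon_single_succ_mul_monBasis]
  congr 1
  rcases mon_single_zero_mul_monBasis hα hd hd0 hc s with ⟨t', ht', h⟩ | ⟨hle, h⟩
  · have hv : boxVec (monBasis hα hd hd0 hc) s.1.1 (s.1.2 + single 0 1) =
        monBasis hα hd hd0 hc t' := by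
      rw [← boxVec_coe, ht']
    have hh : boxHeight t' = boxHeight s + 2 := by
      simp only [boxHeight, boxExp_zero, ht', Finsupp.add_apply, single_eq_same]
      omega
    rw [hv, h, Module.Basis.repr_self, single_apply]
    grind
  · rw [boxVec_of_le _ (i := 0) (by simpa using hle)]
    rcases h with h | ⟨t', r, hlt, h⟩
    · simp [h]
    · rw [h, map_smul, Finsupp.smul_apply, Module.Basis.repr_self, single_apply]
      split_ifs with h1 h2
      · subst h2
        omega
      · simp
      · simp

include hα hd hd0 hc in
/-- For a suitable `μ`, the linear form `μ² x_1 + x_2 + ⋯ + x_n` satisfies the injectivity part of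
the narrow strong Lefschetz property. -/
lemma exists_lefschetz_injective [CharZero k] {D : ℕ}
    (hD : ∀ q, D + Fintype.card (Fin (m + 1)) = 2 * boxOffset d α q + ∑ i, boxSize d α q i) :
    ∃ l ∈ quotientComponent (binomialIdeal d α c) 1, ∀ i, 2 * i ≤ D →
      ∀ a ∈ quotientComponent (binomialIdeal d α c) i, l ^ (D - 2 * i) * a = 0 → a = 0 := by
  classical
  have := Fintype.ofFinite (BoxIndex (boxSize d α))
  set b := monBasis hα hd hd0 hc with hb
  set y := ∑ j : Fin m, mon d α c (single j.succ 1) with hy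
  set x := mon d α c (single 0 1) with hx
  have hpow (e : ℕ) (v) : (LinearMap.toMatrix b b (∑ i, boxRaise b i) ^ e).mulVec (b.repr v) =
      b.repr (((∑ i, boxRaise b i) ^ e) v) := by
    rw [LinearMap.toMatrix_pow, LinearMap.toMatrix_mulVec_repr]
  have hY : ∀ t s, Algebra.leftMulMatrix b y t s ≠ 0 → boxHeight t = boxHeight s := by
    intro t s h
    rw [Algebra.leftMulMatrix_eq_repr_mul, hy, Finset.sum_mul, map_sum, Finsupp.finsetSum_apply]
      at h
    obtain ⟨j, -, hj⟩ := Finset.exists_ne_zero_of_sum_ne_zero h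
    rw [mon_single_succ_mul_monBasis] at hj
    have := eq_of_repr_boxVec_ne_zero _ hj
    simp [boxHeight, this]
  have hT : ∀ t s, Algebra.leftMulMatrix b x t s ≠ 0 → boxHeight t ≤ boxHeight s + 2 := by
    intro t s h
    rw [Algebra.leftMulMatrix_eq_repr_mul] at h
    rcases mon_single_zero_mul_monBasis hα hd hd0 hc s with ⟨t', ht', h'⟩ | ⟨-, h' | ⟨t', r, hlt, h'⟩⟩
    · rw [h', ← hb, b.repr_self, single_apply_ne_zero] at h
      rw [h.1]
      simp only [boxHeight, boxExp_zero, ht', Finsupp.add_apply, single_eq_same]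
      omega
    · rw [h', map_zero] at h
      exact absurd rfl h
    · rw [h', ← hb, map_smul, b.repr_self, Finsupp.smul_apply, smul_ne_zero_iff,
        single_apply_ne_zero] at h
      rw [h.2.1]
      omega
  obtain ⟨μ, -, h⟩ := exists_injective_of_initial_injective _ _
    (LinearMap.toMatrix b b (∑ i, boxRaise b i)) boxHeight hY hT (by
      intro t s
      rw [LinearMap.toMatrix_apply, Algebra.leftMulMatrix_eq_repr_mul,
        Algebra.leftMulMatrix_eq_repr_mul]
      exact repr_sum_boxRaise_monBasis hα hd hd0 hc s t)
    ((Finset.range (D + 1)).filter fun i => 2 * i ≤ D) (fun i => D - 2 * i)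
    (fun i => {s | (boxExp d α s).degree = i}) (by
      intro i hi v hv hMv
      obtain ⟨a, rfl⟩ : ∃ a, v = b.repr a := ⟨b.equivFun.symm v, by
        rw [← b.equivFun_apply, LinearEquiv.apply_symm_apply]⟩
      rw [hpow] at hMv
      have ha := eq_zero_of_sum_boxRaise_pow_eq_zero b (boxOffset d α) D hD
        (by simpa using (Finset.mem_filter.1 hi).2) (v := a)
        (fun s hs => hv s (by rwa [Set.mem_ofPred_eq, degree_boxExp])) (by
          rw [← b.repr.map_eq_zero_iff]
          exact DFunLike.coe_injective hMv)
      rw [ha, map_zero]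
      rfl)
  refine ⟨y + μ ^ 2 • x, ?_, fun i hi a ha hla => ?_⟩
  · refine add_mem (Submodule.sum_mem _ fun j _ => ?_) (Submodule.smul_mem _ _ ?_)
    · simpa using mon_mem_quotientComponent (d := d) (α := α) (c := c) (single j.succ 1)
    · simpa using mon_mem_quotientComponent (d := d) (α := α) (c := c) (single 0 1)
  · rw [mem_quotientComponent_iff hα hd hd0 hc] at ha
    have h0 := h i (by simp; omega) (b.repr a) (fun s hs => ha s hs) (by
      rw [← map_smul, ← map_add, ← map_pow, Algebra.leftMulMatrix_mulVec_repr, hla, map_zero]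
      rfl)
    rw [← b.repr.map_eq_zero_iff]
    exact DFunLike.coe_injective h0

include hα hd hd0 hc in
theorem hasSLP_binomialIdeal [CharZero k] (hK : binomialIdeal d α c ≠ ⊤) :
    HasSLP (binomialIdeal d α c) := by
  let b := monBasis hα hd hd0 hc
  have hfin := Module.Finite.of_basis b
  have hD := socleDegree_add (c := c) hα hd hd0 hK
  obtain ⟨l, hl, hinj⟩ := exists_lefschetz_injective hα hd hd0 hc hD
  refine ⟨isHomogeneous_binomialIdeal hd, IsArtinianRing.of_finite k _, l, hl,
    maximal_rank_of_narrow hl (D := socleDegree d α) ?_ hinj ?_⟩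
  · intro i hi
    rw [eq_bot_iff]
    intro a ha
    rw [mem_quotientComponent_iff hα hd hd0 hc] at ha
    rw [Submodule.mem_bot, ← b.repr.map_eq_zero_iff]
    ext s
    refine ha s ?_
    have := degree_boxExp_boxRev hD s
    omega
  · intro i hi y hy
    have hmap : ∀ a ∈ quotientComponent (binomialIdeal d α c) i,
        LinearMap.mulLeft k (l ^ (socleDegree d α - 2 * i)) a ∈
          quotientComponent (binomialIdeal d α c) (socleDegree d α - i) := fun a ha => by
      have := pow_mul_mem_quotientComponent hl ha (socleDegree d α - 2 * i)
      rwa [show i + (socleDegree d α - 2 * i) = socleDegree d α - i by omega] at this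
    let f := (LinearMap.mulLeft k (l ^ (socleDegree d α - 2 * i))).restrict hmap
    have hf : Function.Injective f := by
      rw [← LinearMap.ker_eq_bot, LinearMap.ker_eq_bot']
      intro a ha
      exact Subtype.ext (hinj i hi a a.2 (congrArg Subtype.val ha))
    -- Injectivity and the reversal symmetry give equal dimensions, so the map is also onto.
    have hrank := (LinearMap.finrank_le_finrank_of_injective hf).antisymm
      (finrank_quotientComponent_le hα hd hd0 hc hD (by omega))
    obtain ⟨x, hx⟩ := (LinearMap.injective_iff_surjective_of_finrank_eq_finrank hrank).1 hf ⟨y, hy⟩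
    exact ⟨x, x.2, congrArg Subtype.val hx⟩

end Lefschetz

theorem theorem3p2 {k : Type u} [Field k] [CharZero k] {m : ℕ} (d α : Fin (m + 1) → ℕ) (c : k)
    (hα : ∀ i, α i ≤ d i) (hd : d 0 = ∑ j : Fin m, α j.succ) (hc : c ≠ 0)
    (hdeg : d 0 = 0 → c ≠ -1) (hK : binomialIdeal d α c ≠ ⊤) :
    IsGorensteinRing (MvPolynomial (Fin (m + 1)) k ⧸ binomialIdeal d α c) ∧
      HasSLP (binomialIdeal d α c) := by
  -- If `d 0 = 0`, the binomial is the constant `1 + c`, a unit, contradicting properness.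
  have hd0 : 0 < d 0 := by
    by_contra h
    have h0 : d 0 = 0 := by omega
    have hαj : tailExp α = 0 := by
      rw [← Finsupp.degree_eq_zero_iff, degree_tailExp, ← hd, h0]
    refine hK (Ideal.eq_top_of_isUnit_mem _ (x := MvPolynomial.C (1 + c)) ?_ ?_)
    · rw [binomialIdeal_eq_span]
      refine Ideal.subset_span (Or.inl (Or.inl ?_))
      rw [h0, hαj, Finsupp.single_zero, Set.mem_singleton_iff, MvPolynomial.monomial_zero']
      simp
    · refine (IsUnit.mk0 (1 + c) fun h => hdeg h0 ?_).map MvPolynomial.C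
      linear_combination h
  exact ⟨isGorensteinRing_quotient_binomialIdeal hα hd hd0 hc,
    hasSLP_binomialIdeal hα hd hd0 hc hK⟩
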